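/- **Setting.** There are finitely many clients; client $i$ holds a finite local dataset $D_i$ of distinct records, and $\mathcal D=(D_i)_i$ is the federated dataset. For a record $d=d_{i,j}\in D_i$ let $D_{i,-j}=D_i\setminus\{d\}$, and let $\mathcal D_{-i,j}$ be $\mathcal D$ with $D_i$ replaced by $D_{i,-j}$. For $\alpha>1$ and probability measures $P,Q$ let $D_\alpha(P\|Q)=\frac1{\alpha-1}\ln\int\left(\frac{dP}{dQ}\right)^\alpha dQ$ if $P\ll Q$, and $D_\alpha(P\|Q)=+\infty$ otherwise. A randomized algorithm $\mathcal A$ on local datasets of client $i$ (resp. on federated datasets) is $(\alpha,\rho)$-RDP with respect to $d_{i,j}$ if $\max\{D_\alpha(\mathcal A(D)\|\mathcal A(D')),D_\alpha(\mathcal A(D')\|\mathcal A(D))\}\le\rho$ for all pairs $(D,D')=(D_i,D_{i,-j})$ (resp. $(\mathcal D,\mathcal D_{-i,j})$) with $d_{i,j}\in D_i$. In one round with current global model $x$, every client is sampled independently with probability $\lambda\in(0,1]$; the sampled clients independently run local algorithms $\mathcal A_{in}(D_k,x)$ with values in a separable real normed space; and $\mathcal A_{out}(\mathcal D)$ is the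 average of their outputs (and is $x$ if no client is sampled). **Lemma (Enhanced privacy amplification by two-stage hybrid sampling).** Let $\lambda\in(0,1]$, and let each record $d_{k,l}$ have a sampling probability $q_{k,l}\in(0,1]$. 1. Let $\alpha>1$ be real. For arbitrary local randomized algorithms, if $\mathcal A_{in}(D_i,x)$ is $(\alpha,\rho)$-RDP with respect to $d_{i,j}$, then $\mathcal A_{out}(\mathcal D)$ is $(\alpha,\rho^{\lambda})$-RDP with respect to $d_{i,j}$, where $$\rho^{\lambda}=\frac1{\alpha-1}\ln\left\{1-\lambda+\lambda e^{(\alpha-1)\rho}\right\}.$$ 2. Let $\sigma>0$, let $\tau\ge0$ be an integer, and let the local multi-step update of each client be the $\tau$-fold adaptive composition of Poisson-sampled Gaussian mechanisms in $\mathbb R^n$: in step $r$ a fresh subset $S\subseteq D_k$ is drawn, which contains each $d_{k,l}\in D_k$ independently with probability $q_{k,l}$, and $f_{k,r}(x,\text{previous outputs},S)+\mathcal N(0,\sigma^2 I)$ is released, where $f_{k,r}$ is measurable in the previous outputs and changes in Euclidean norm by at most $1$ when one record is added to $S$. Then for every integer $\alpha\ge2$ the tuple of the $\tau$ outputs of client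 $i$ is $(\alpha,\rho^\tau_{i,j})$-RDP with respect to $d_{i,j}$, where, with $\rho_G(\ell)=\ell/(2\sigma^2)$, $$\rho^\tau_{i,j}=\frac{\tau}{\alpha-1}\ln\left\{(1-q_{i,j})^{\alpha-1}(\alpha q_{i,j}-q_{i,j}+1)+\sum_{\ell=2}^{\alpha}\binom{\alpha}{\ell}(1-q_{i,j})^{\alpha-\ell}q_{i,j}^{\ell}e^{(\ell-1)\rho_G(\ell)}\right\}.$$ Consequently, if the output $\mathcal A_{in}(D_k,x)$ of each client is a measurable function, not depending on the data, of its tuple of $\tau$ outputs (for instance the tuple itself or the final local model), then $\mathcal A_{out}(\mathcal D)$ is $(\alpha,\rho^{\tau,\lambda}_{i,j})$-RDP with respect to $d_{i,j}$, where $$\rho^{\tau,\lambda}_{i,j}=\frac1{\alpha-1}\ln\left\{1-\lambda+\lambda e^{(\alpha-1)\rho^\tau_{i,j}}\right\}.$$ -/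

import Mathlib

open MeasureTheory ProbabilityTheory

noncomputable section

/-! ### Rényi divergence and Rényi differential privacy -/

/-- Rényi divergence of order `α > 1` of `P` from `Q`, an extended real number:
`(α - 1)⁻¹ * log E_{o ∼ Q} [(dP/dQ (o)) ^ α]` if `P ≪ Q`, and `+∞` otherwise. -/
def renyiDiv {Ω : Type*} [MeasurableSpace Ω] (α : ℝ) (P Q : Measure Ω) : EReal :=
  open Classical in
  if P ≪ Q then
    (((α - 1)⁻¹ : ℝ) : EReal) * ENNReal.log (∫⁻ o, (P.rnDeriv Q o) ^ α ∂Q)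
  else ⊤

/-- `(α, ρ)`-RDP of a randomized algorithm `A` (a map sending a dataset to its output law), relative
to an adjacency relation on datasets: both Rényi divergences are at most `ρ` on all adjacent
pairs. -/
def IsRDP {𝔻 Ω : Type*} [MeasurableSpace Ω] (adj : 𝔻 → 𝔻 → Prop) (α ρ : ℝ)
    (A : 𝔻 → Measure Ω) : Prop :=
  ∀ D D' : 𝔻, adj D D' →
    max (renyiDiv α (A D) (A D')) (renyiDiv α (A D') (A D)) ≤ (ρ : EReal)

/-- Record-specific adjacency of local datasets: `D` contains `d`, and `D' = D \ {d}`. -/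
def LocalAdj {X : Type*} [DecidableEq X] (d : X) (D D' : Finset X) : Prop :=
  d ∈ D ∧ D' = D.erase d

/-- Record-specific adjacency of federated datasets (one local dataset for each client): the local
dataset of client `i` contains `d`, and `𝒟'` arises from `𝒟` by deleting `d` at client `i`. -/
def FedAdj {ι X : Type*} [DecidableEq ι] [DecidableEq X] (i : ι) (d : X)
    (𝒟 𝒟' : ι → Finset X) : Prop :=
  d ∈ 𝒟 i ∧ 𝒟' = Function.update 𝒟 i ((𝒟 i).erase d)

/-! ### Poisson sampling and the local multi-step update -/

/-- The probability that Poisson sampling from `D`, in which each `x ∈ D` is included independently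
with probability `q x`, returns the subset `S` of `D`. -/
def poissonWeight {X : Type*} [DecidableEq X] (q : X → ℝ) (D S : Finset X) : ℝ :=
  ∏ x ∈ D, if x ∈ S then q x else 1 - q x

/-- The Gaussian mechanism: the law of `v + ζ`, where `ζ ∼ 𝒩(0, σ² I)`. -/
def gaussianMech {n : ℕ} (σ : ℝ) (v : EuclideanSpace ℝ (Fin n)) :
    Measure (EuclideanSpace ℝ (Fin n)) :=
  (stdGaussian (EuclideanSpace ℝ (Fin n))).map (fun z => v + σ • z)

/-- The Poisson-sampled Gaussian mechanism: the law of `f S + ζ`, where `S ⊆ D` is drawn by Poisson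
sampling with probabilities `q` and `ζ ∼ 𝒩(0, σ² I)` is independent of `S`. -/
def poiSG {X : Type*} [DecidableEq X] {n : ℕ} (σ : ℝ) (q : X → ℝ)
    (f : Finset X → EuclideanSpace ℝ (Fin n)) (D : Finset X) :
    Measure (EuclideanSpace ℝ (Fin n)) :=
  ∑ S ∈ D.powerset, ENNReal.ofReal (poissonWeight q D S) • gaussianMech σ (f S)

/-- The `τ`-fold adaptive composition of Poisson-sampled Gaussian mechanisms, that is, the joint law
of the outputs of all `τ` steps. In step `r` the query `f r h` depends on the vector `h` of the
outputs of the preceding steps, and a fresh subset of the dataset is sampled. -/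
def poiSGComp {X : Type*} [DecidableEq X] {n : ℕ} (σ : ℝ) (q : X → ℝ)
    (f : (r : ℕ) → (Fin r → EuclideanSpace ℝ (Fin n)) → Finset X → EuclideanSpace ℝ (Fin n))
    (D : Finset X) : (τ : ℕ) → Measure (Fin τ → EuclideanSpace ℝ (Fin n))
  | 0 => Measure.dirac Fin.elim0
  | r + 1 => (poiSGComp σ q f D r).bind fun h =>
      (poiSG σ q (f r h) D).map fun y =>
        (Fin.snoc h y : Fin (r + 1) → EuclideanSpace ℝ (Fin n))

/-! ### Client sampling and averaging -/

/-- The average of the vectors `y i`, `i ∈ ω`; if `ω` is empty (no client was sampled), the global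
model `x` stays as it is. -/
def clientAvg {ι V : Type*} [AddCommGroup V] [Module ℝ V] (x : V) (ω : Finset ι)
    (y : ω → V) : V :=
  open Classical in if ω.Nonempty then (ω.card : ℝ)⁻¹ • ∑ i, y i else x

/-- One round of global aggregation from the global model `x`: each client is included in the
sample `ω` independently with probability `lam`, the sampled clients run their local
algorithms `A i (𝒟 i) x` independently, and the outputs are averaged. -/
def globalRound {ι X V : Type*} [Fintype ι] [DecidableEq ι] [AddCommGroup V] [Module ℝ V]
    [MeasurableSpace V] (lam : ℝ) (A : ι → Finset X → V → Measure V) (x : V)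
    (𝒟 : ι → Finset X) : Measure V :=
  ∑ ω : Finset ι, ENNReal.ofReal (poissonWeight (fun _ => lam) Finset.univ ω) •
    (Measure.pi fun i : ω => A i (𝒟 i) x).map (clientAvg x ω)

/-! ### The privacy bounds -/

/-- The RDP curve `α ↦ α / (2 σ²)` of the Gaussian mechanism with sensitivity one. -/
def rhoG (σ α : ℝ) : ℝ := α / (2 * σ ^ 2)

/-- The bound for the Poisson-sampled Gaussian mechanism at integer order `α` and rate `q`. -/
def rhoPoiSG (σ : ℝ) (α : ℕ) (q : ℝ) : ℝ :=
  1 / ((α : ℝ) - 1) * Real.log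
    ((1 - q) ^ (α - 1) * (α * q - q + 1) +
      ∑ l ∈ Finset.Icc 2 α,
        (α.choose l : ℝ) * (1 - q) ^ (α - l) * q ^ l * Real.exp (((l : ℝ) - 1) * rhoG σ l))

/-- The amplified bound `1 / (α - 1) * ln (1 - λ + λ * exp ((α - 1) * ρ))`. -/
def rhoAmp (lam α ρ : ℝ) : ℝ :=
  1 / (α - 1) * Real.log (1 - lam + lam * Real.exp ((α - 1) * ρ))

end

open scoped ENNReal RealInnerProductSpace

noncomputable section

/-! A bound on the Rényi divergence is a bound on `∫ (dP/dQ) ^ α ∂Q`, and by Hölder duality this is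
an inequality between integrals of test functions, `MomentBound`, with no density in it
(`renyiDiv_le_iff`). In this form post-processing, mixing, adaptive composition and changing one
factor of a product become short: constants are averaged by mixtures (`sum`), multiplied by kernels
(`bind`), and kept by maps and by products that differ in one coordinate (`map`, `pi`).

Client sampling: conditionally on the other sampled clients, the target client is absent (constant
`1`) or present (constant `e ^ ((α - 1) ρ)`). Averaging with weights `1 - λ` and `λ` gives exactly
the amplified bound.

Local update: conditionally on the other sampled records, one step compares `(1 - q) γ + q γ_a` with
`γ`, where `γ` is standard Gaussian, `γ_a` its translate by `a`, and `‖a‖ ≤ 1 / σ`. The density is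
`m = 1 - q + q r` with `r = dγ_a/dγ`. In one direction the binomial theorem and `∫ r ^ l ∂γ = exp (l
(l - 1) ‖a‖² / 2)` give the stated sum. In the other, the moment is `∫ m ^ (1 - α) ∂γ`, which is at
most `∫ m ^ α ∂γ`: the reflection `z ↦ a - z` swaps `γ` with `γ_a` and `r` with `1 / r`, which
reduces this to the pointwise inequality `inv_pow_add_le_pow_add`. -/

/-- The Hölder dual form of the bound `∫ (dP/dQ) ^ α ∂Q ≤ C`. -/
def MomentBound {Ω : Type*} [MeasurableSpace Ω] (α : ℝ) (C : ℝ≥0∞) (P Q : Measure Ω) : Prop :=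
  ∀ φ : Ω → ℝ≥0∞, Measurable φ →
    ∫⁻ o, φ o ∂P ≤ C ^ (1 / α) * (∫⁻ o, φ o ^ α.conjExponent ∂Q) ^ (1 / α.conjExponent)

/-! ### Closure properties of the dual moment bound, and its equivalence with the Rényi bound. -/

namespace MomentBound

variable {Ω Ω' : Type*} [MeasurableSpace Ω] [MeasurableSpace Ω'] {α : ℝ} {C C' : ℝ≥0∞}
  {P Q : Measure Ω}

theorem of_withDensity (hα : 1 < α) {r : Ω → ℝ≥0∞} (hr : Measurable r)
    (hC : ∫⁻ o, r o ^ α ∂Q ≤ C) : MomentBound α C (Q.withDensity r) Q := by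
  intro φ hφ
  rw [lintegral_withDensity_eq_lintegral_mul _ hr hφ]
  refine (ENNReal.lintegral_mul_le_Lp_mul_Lq Q (Real.HolderConjugate.conjExponent hα)
    hr.aemeasurable hφ.aemeasurable).trans ?_
  gcongr

theorem refl (hα : 1 < α) (Q : Measure Ω) [IsProbabilityMeasure Q] : MomentBound α 1 Q Q := by
  simpa using of_withDensity (Q := Q) (C := 1) (r := 1) hα measurable_one (by simp)

theorem map (h : MomentBound α C P Q) {g : Ω → Ω'} (hg : Measurable g) :
    MomentBound α C (P.map g) (Q.map g) := by
  intro φ hφ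
  rw [lintegral_map hφ hg, lintegral_map (hφ.pow_const _) hg]
  exact h _ (hφ.comp hg)

/-- Each weight splits as `w ^ (1 / α) * w ^ (1 / β)`, and Hölder for finite sums recombines the
terms. The constants are averaged, not replaced by their maximum; the amplification rests on this.
-/
theorem sum (hα : 1 < α) {κ : Type*} (s : Finset κ) (w : κ → ℝ≥0∞) (c : κ → ℝ≥0∞)
    {P Q : κ → Measure Ω} (h : ∀ k ∈ s, MomentBound α (c k) (P k) (Q k)) :
    MomentBound α (∑ k ∈ s, w k * c k) (∑ k ∈ s, w k • P k) (∑ k ∈ s, w k • Q k) := by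
  intro φ hφ
  have hc := Real.HolderConjugate.conjExponent hα
  set β := α.conjExponent
  have hα0 : α ≠ 0 := hc.ne_zero
  have hβ0 : β ≠ 0 := hc.symm.ne_zero
  have hsum : 1 / α + 1 / β = 1 := by simpa using hc.inv_add_inv_eq_one
  simp only [lintegral_finsetSum_measure, lintegral_smul_measure, smul_eq_mul]
  calc ∑ k ∈ s, w k * ∫⁻ o, φ o ∂P k
      ≤ ∑ k ∈ s, (w k * c k) ^ (1 / α) * (w k * ∫⁻ o, φ o ^ β ∂Q k) ^ (1 / β) := by
        refine Finset.sum_le_sum fun k hk => ?_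
        rw [ENNReal.mul_rpow_of_nonneg _ _ hc.one_div_nonneg,
          ENNReal.mul_rpow_of_nonneg _ _ hc.symm.one_div_nonneg, mul_mul_mul_comm,
          ← ENNReal.rpow_add_of_nonneg _ _ hc.one_div_nonneg hc.symm.one_div_nonneg, hsum,
          ENNReal.rpow_one]
        gcongr
        exact h k hk φ hφ
    _ ≤ _ := by
        refine (ENNReal.inner_le_Lp_mul_Lq s _ _ hc).trans_eq ?_
        simp only [← ENNReal.rpow_mul, one_div_mul_cancel hα0, one_div_mul_cancel hβ0,
          ENNReal.rpow_one]

/-- The inner bound turns `φ` into the test function `(∫ φ ^ β ∂η o) ^ (1 / β)` for the outer bound,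
whose power `β` undoes the root. -/
theorem bind (hα : 1 < α) (h : MomentBound α C P Q) {κ η : Ω → Measure Ω'} (hκ : Measurable κ)
    (hη : Measurable η) (hκη : ∀ o, MomentBound α C' (κ o) (η o)) :
    MomentBound α (C * C') (P.bind κ) (Q.bind η) := by
  intro φ hφ
  have hc := Real.HolderConjugate.conjExponent hα
  rw [Measure.lintegral_bind hκ.aemeasurable hφ.aemeasurable,
    Measure.lintegral_bind hη.aemeasurable (hφ.pow_const _).aemeasurable]
  have hm : Measurable fun o => ∫⁻ y, φ y ^ α.conjExponent ∂η o :=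
    (Measure.measurable_lintegral (hφ.pow_const _)).comp hη
  calc ∫⁻ o, ∫⁻ y, φ y ∂κ o ∂P
      ≤ ∫⁻ o, C' ^ (1 / α) * (∫⁻ y, φ y ^ α.conjExponent ∂η o) ^ (1 / α.conjExponent) ∂P :=
        lintegral_mono fun o => hκη o φ hφ
    _ = C' ^ (1 / α) * ∫⁻ o, (∫⁻ y, φ y ^ α.conjExponent ∂η o) ^ (1 / α.conjExponent) ∂P :=
        lintegral_const_mul _ (hm.pow_const _)
    _ ≤ C' ^ (1 / α) * (C ^ (1 / α) * (∫⁻ o, ((∫⁻ y, φ y ^ α.conjExponent ∂η o) ^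
          (1 / α.conjExponent)) ^ α.conjExponent ∂Q) ^ (1 / α.conjExponent)) := by
        gcongr
        exact h _ (hm.pow_const _)
    _ = _ := by
        simp only [← ENNReal.rpow_mul, one_div_mul_cancel hc.symm.ne_zero, ENNReal.rpow_one]
        rw [ENNReal.mul_rpow_of_nonneg _ _ hc.one_div_nonneg, ← mul_assoc,
          mul_comm (C ^ _)]

theorem pi (hα : 1 < α) {κ : Type*} [Fintype κ] [DecidableEq κ] {E : κ → Type*}
    [∀ k, MeasurableSpace (E k)] {μ ν : ∀ k, Measure (E k)} [∀ k, IsProbabilityMeasure (μ k)]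
    [∀ k, IsProbabilityMeasure (ν k)] (k : κ) (hk : MomentBound α C (μ k) (ν k))
    (hne : ∀ j, j ≠ k → μ j = ν j) :
    MomentBound α C (Measure.pi μ) (Measure.pi ν) := by
  intro φ hφ
  have hc := Real.HolderConjugate.conjExponent hα
  set β := α.conjExponent
  have x : ∀ j, E j := fun j => (nonempty_of_isProbabilityMeasure (μ j)).some
  have hR : (Measure.pi fun j : (Finset.univ.erase k : Finset κ) => μ j) =
      Measure.pi fun j : (Finset.univ.erase k : Finset κ) => ν j := by
    congr 1
    funext j
    exact hne j (Finset.ne_of_mem_erase j.2)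
  have hm : Measurable fun x : ∀ j, E j => ∫⁻ y, φ (Function.update x k y) ^ β ∂ν k := by
    refine Measurable.lintegral_prod_right ?_
    exact (hφ.comp measurable_update').pow_const _
  rw [lintegral_eq_lmarginal_univ x, lintegral_eq_lmarginal_univ x,
    lmarginal_erase' φ hφ (Finset.mem_univ k),
    lmarginal_erase' _ (hφ.pow_const β) (Finset.mem_univ k)]
  simp only [lmarginal]
  rw [hR]
  set R := Measure.pi fun j : (Finset.univ.erase k : Finset κ) => ν j
  have hm' : Measurable fun y : ∀ j : (Finset.univ.erase k : Finset κ), E j =>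
      ∫⁻ z, φ (Function.update (Function.updateFinset x (Finset.univ.erase k) y) k z) ^ β ∂ν k :=
    hm.comp (measurable_updateFinset (s := Finset.univ.erase k) (x := x))
  refine (lintegral_mono fun y => hk _ (hφ.comp (measurable_update _))).trans ?_
  simp only [Function.comp_apply]
  rw [lintegral_const_mul _ (hm'.pow_const _)]
  gcongr
  -- With constant `1` on a probability measure, the bound is Jensen's inequality, which moves the
  -- root outside the integral.
  refine (refl hα R _ (hm'.pow_const _)).trans_eq ?_
  simp [← ENNReal.rpow_mul, β, hc.symm.ne_zero]

theorem absolutelyContinuous (hα : 1 < α) (h : MomentBound α C P Q) : P ≪ Q := by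
  refine Measure.AbsolutelyContinuous.mk fun s hs hQ => ?_
  have hc := Real.HolderConjugate.conjExponent hα
  have := h (s.indicator 1) (measurable_one.indicator hs)
  have e : (fun o => (s.indicator (1 : Ω → ℝ≥0∞) o) ^ α.conjExponent) = s.indicator 1 := by
    funext o
    by_cases ho : o ∈ s <;> simp [ho, hc.symm.pos]
  rw [e, lintegral_indicator_one hs, lintegral_indicator_one hs, hQ,
    ENNReal.zero_rpow_of_pos (by simpa using hc.symm.pos), mul_zero] at this
  simpa using this

/-- The extremal test function is `r ^ (α - 1)`, with `r = dP/dQ`. Truncating `r` at `n` makes the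
moment finite, so that it can be cancelled; monotone convergence removes the truncation. -/
theorem lintegral_rnDeriv_rpow_le (hα : 1 < α) [IsFiniteMeasure P] [IsFiniteMeasure Q]
    (h : MomentBound α C P Q) : ∫⁻ o, P.rnDeriv Q o ^ α ∂Q ≤ C := by
  have hc := Real.HolderConjugate.conjExponent hα
  have hPQ := h.absolutelyContinuous hα
  have hα0 : 0 < α := hc.pos
  have hr := Measure.measurable_rnDeriv P Q
  set r := P.rnDeriv Q
  have key : ∀ n : ℕ, ∫⁻ o, min (r o) n ^ α ∂Q ≤ C := by
    intro n
    set I := ∫⁻ o, min (r o) n ^ α ∂Q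
    have hI : I ≠ ∞ := by
      refine ne_top_of_le_ne_top (b := ∫⁻ _, (n : ℝ≥0∞) ^ α ∂Q) ?_ ?_
      · simpa using ENNReal.mul_ne_top (by simp [hα0.le]) (measure_ne_top Q _)
      · exact lintegral_mono fun o => by dsimp only; gcongr; exact min_le_right _ _
    have hmin : Measurable fun o => min (r o) (n : ℝ≥0∞) := hr.min measurable_const
    have h1 := h _ (hmin.pow_const (α - 1))
    have e : (α - 1) * α.conjExponent = α := hc.sub_one_mul_conj
    simp only [← ENNReal.rpow_mul, e] at h1
    have h2 : I ≤ ∫⁻ o, min (r o) n ^ (α - 1) ∂P := by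
      rw [← lintegral_rnDeriv_mul hPQ (hmin.pow_const _).aemeasurable]
      refine lintegral_mono fun o => ?_
      calc min (r o) n ^ α = min (r o) n ^ (1 + (α - 1)) := by ring_nf
        _ = min (r o) n * min (r o) n ^ (α - 1) := by
          rw [ENNReal.rpow_add_of_nonneg _ _ zero_le_one (by linarith), ENNReal.rpow_one]
        _ ≤ _ := by gcongr; exact min_le_left _ _
    rcases eq_or_ne I 0 with h0 | h0
    · simp [h0]
    have h3 : I ^ (1 / α) * I ^ (1 / α.conjExponent) ≤ C ^ (1 / α) * I ^ (1 / α.conjExponent) := by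
      rw [← ENNReal.rpow_add _ _ h0 hI]
      simpa [hc.inv_add_inv_eq_one] using h2.trans h1
    have h4 := (ENNReal.mul_le_mul_iff_left
      (by simp [h0, hI]) (by simp [h0, hI])).1 h3
    exact (ENNReal.rpow_le_rpow_iff (by simpa using hα0)).1 h4
  have hsup : ∀ o, r o ^ α = ⨆ n : ℕ, min (r o) n ^ α := by
    intro o
    have : r o = ⨆ n : ℕ, min (r o) n := by
      rw [← inf_iSup_eq, ENNReal.iSup_natCast, inf_top_eq]
    conv_lhs => rw [this]
    exact (ENNReal.orderIsoRpow α hα0).map_iSup _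
  simp only [hsup]
  rw [lintegral_iSup (fun n => (hr.min measurable_const).pow_const _)]
  · exact iSup_le key
  · intro m n hmn o
    dsimp only
    gcongr

end MomentBound

/-- The value `⊤` causes no exception: the dual bound with a finite constant already forces `P ≪ Q`.
-/
theorem renyiDiv_le_iff {Ω : Type*} [MeasurableSpace Ω] {α ρ : ℝ} (hα : 1 < α) (P Q : Measure Ω)
    [IsFiniteMeasure P] [IsFiniteMeasure Q] :
    renyiDiv α P Q ≤ ρ ↔ MomentBound α (ENNReal.ofReal (Real.exp ((α - 1) * ρ))) P Q := by
  have key : ∀ I : ℝ≥0∞, (((α - 1)⁻¹ : ℝ) : EReal) * ENNReal.log I ≤ ρ ↔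
      I ≤ ENNReal.ofReal (Real.exp ((α - 1) * ρ)) := by
    intro I
    have hpos : (0 : EReal) < ((α - 1 : ℝ) : EReal) := by exact_mod_cast sub_pos.2 hα
    rw [EReal.coe_inv, ← EReal.div_eq_inv_mul, EReal.div_le_iff_le_mul hpos (EReal.coe_ne_top _),
      ← EReal.exp_coe, ← ENNReal.log_le_log_iff, EReal.log_exp, EReal.coe_mul]
  constructor
  · intro h
    unfold renyiDiv at h
    split_ifs at h with hPQ
    · rw [← Measure.withDensity_rnDeriv_eq P Q hPQ]
      exact .of_withDensity hα (Measure.measurable_rnDeriv P Q) ((key _).1 h)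
    · simp at h
  · intro h
    rw [renyiDiv, if_pos (h.absolutelyContinuous hα), key]
    exact h.lintegral_rnDeriv_rpow_le hα

/-! ### Translates of the standard Gaussian measure -/

theorem gaussianReal_withDensity_exp (a : ℝ) :
    (gaussianReal 0 1).withDensity (fun x => ENNReal.ofReal (Real.exp (a * x - a ^ 2 / 2))) =
      gaussianReal a 1 := by
  rw [gaussianReal_of_var_ne_zero _ one_ne_zero, gaussianReal_of_var_ne_zero _ one_ne_zero,
    ← withDensity_mul _ (measurable_gaussianPDF _ _) (by fun_prop)]
  congr 1
  funext x
  simp only [Pi.mul_apply, gaussianPDF, gaussianPDFReal]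
  rw [← ENNReal.ofReal_mul (by positivity), mul_assoc, ← Real.exp_add]
  congr 3
  simp
  ring

theorem pi_withDensity_prod {κ : Type*} [Fintype κ] {E : κ → Type*} [∀ k, MeasurableSpace (E k)]
    (μ : ∀ k, Measure (E k)) [∀ k, IsProbabilityMeasure (μ k)] (g : ∀ k, E k → ℝ≥0∞)
    (hg : ∀ k, Measurable (g k)) [∀ k, SigmaFinite ((μ k).withDensity (g k))] :
    (Measure.pi μ).withDensity (fun x => ∏ k, g k (x k)) =
      Measure.pi fun k => (μ k).withDensity (g k) := by
  refine (Measure.pi_eq fun s hs => ?_).symm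
  have hm : ∀ k, Measurable ((s k).indicator (g k)) := fun k => (hg k).indicator (hs k)
  have he : (Set.univ.pi s).indicator (fun x => ∏ k, g k (x k)) =
      fun x => ∏ k, (s k).indicator (g k) (x k) := by
    funext x
    by_cases hx : x ∈ Set.univ.pi s
    · rw [Set.indicator_of_mem hx]
      exact Finset.prod_congr rfl fun k _ => (Set.indicator_of_mem (hx k trivial) _).symm
    · rw [Set.indicator_of_notMem hx]
      simp only [Set.mem_pi, Set.mem_univ, true_implies, not_forall] at hx
      obtain ⟨k, hk⟩ := hx
      exact (Finset.prod_eq_zero (Finset.mem_univ k) (Set.indicator_of_notMem hk _)).symm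
  rw [withDensity_apply _ (.univ_pi hs), ← lintegral_indicator (.univ_pi hs), he]
  refine (lintegral_prod_eq_prod_lintegral_of_indepFun Finset.univ
      (fun k (x : ∀ k, E k) => (s k).indicator (g k) (x k))
      (iIndepFun_pi fun k => (hm k).aemeasurable)
      (fun k => (hm k).comp (measurable_pi_apply k))).trans ?_
  refine Finset.prod_congr rfl fun k _ => ?_
  rw [withDensity_apply _ (hs k), ← lintegral_indicator (hs k),
    (measurePreserving_eval μ k).lintegral_comp (hm k)]

variable {n : ℕ}

/-- The density of the translate by `a` of the standard Gaussian measure, with respect to the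
standard Gaussian measure. -/
def gaussianRatio (a z : EuclideanSpace ℝ (Fin n)) : ℝ := Real.exp (⟪a, z⟫ - ‖a‖ ^ 2 / 2)

theorem gaussianRatio_pos (a z : EuclideanSpace ℝ (Fin n)) : 0 < gaussianRatio a z :=
  Real.exp_pos _

theorem measurable_gaussianRatio (a : EuclideanSpace ℝ (Fin n)) : Measurable (gaussianRatio a) := by
  unfold gaussianRatio
  fun_prop

theorem gaussianRatio_sub (a z : EuclideanSpace ℝ (Fin n)) :
    gaussianRatio a (a - z) = (gaussianRatio a z)⁻¹ := by
  rw [gaussianRatio, gaussianRatio, ← Real.exp_neg, inner_sub_right, real_inner_self_eq_norm_sq]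
  ring_nf

/-- The Cameron–Martin formula, obtained coordinatewise from the one-dimensional densities. -/
theorem stdGaussian_map_add (a : EuclideanSpace ℝ (Fin n)) :
    (stdGaussian (EuclideanSpace ℝ (Fin n))).map (fun z => z + a) =
      (stdGaussian _).withDensity fun z => ENNReal.ofReal (gaussianRatio a z) := by
  have hr := (measurable_gaussianRatio a).ennreal_ofReal
  have hL : Measurable (WithLp.toLp 2 : (Fin n → ℝ) → EuclideanSpace ℝ (Fin n)) :=
    WithLp.measurable_toLp 2 _
  have hadd : Measurable fun z : EuclideanSpace ℝ (Fin n) => z + a := by fun_prop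
  have hpi : (Measure.pi fun _ : Fin n => gaussianReal 0 1).withDensity
      (fun x => ENNReal.ofReal (gaussianRatio a (WithLp.toLp 2 x))) =
      (Measure.pi fun _ : Fin n => gaussianReal 0 1).map (fun x k => x k + a k) := by
    rw [Measure.pi_map_pi (f := fun k x => x + a k) (fun k => by fun_prop)]
    simp only [gaussianReal_map_add_const, zero_add]
    have : ∀ k, SigmaFinite ((gaussianReal 0 1).withDensity
        fun x => ENNReal.ofReal (Real.exp (a k * x - a k ^ 2 / 2))) := fun k => by
      rw [gaussianReal_withDensity_exp]; infer_instance
    have hdens : (fun k => gaussianReal (a k) 1) = fun k => (gaussianReal 0 1).withDensity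
        fun x => ENNReal.ofReal (Real.exp (a k * x - a k ^ 2 / 2)) :=
      funext fun k => (gaussianReal_withDensity_exp (a k)).symm
    rw [hdens, ← pi_withDensity_prod _ _ (fun k => by fun_prop)]
    congr 1
    funext x
    rw [← ENNReal.ofReal_prod_of_nonneg (fun k _ => (Real.exp_pos _).le), ← Real.exp_sum,
      gaussianRatio, EuclideanSpace.norm_sq_eq, PiLp.inner_apply, Finset.sum_sub_distrib,
      Finset.sum_div]
    simp [mul_comm]
  rw [← map_pi_eq_stdGaussian, Measure.map_map hadd hL]
  refine Measure.ext fun s hs => ?_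
  rw [withDensity_apply _ hs, setLIntegral_map hs hr hL, ← withDensity_apply _ (hL hs), hpi,
    Measure.map_apply (hadd.comp hL) hs,
    Measure.map_apply (measurable_pi_lambda _ fun k => by fun_prop) (hL hs)]
  rfl

/-- Completing the square makes the power a constant times the ratio for `l • a`, which is a
probability density. -/
theorem lintegral_gaussianRatio_pow (a : EuclideanSpace ℝ (Fin n)) (l : ℕ) :
    ∫⁻ z, ENNReal.ofReal (gaussianRatio a z) ^ l ∂stdGaussian (EuclideanSpace ℝ (Fin n)) =
      ENNReal.ofReal (Real.exp (l * (l - 1) / 2 * ‖a‖ ^ 2)) := by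
  have h : ∀ z, ENNReal.ofReal (gaussianRatio a z) ^ l =
      ENNReal.ofReal (Real.exp (l * (l - 1) / 2 * ‖a‖ ^ 2)) *
        ENNReal.ofReal (gaussianRatio ((l : ℝ) • a) z) := by
    intro z
    rw [← ENNReal.ofReal_pow (gaussianRatio_pos a z).le, ← ENNReal.ofReal_mul (Real.exp_pos _).le,
      gaussianRatio, gaussianRatio, ← Real.exp_nat_mul, ← Real.exp_add, real_inner_smul_left,
      norm_smul]
    congr 2
    simp only [Real.norm_natCast]
    ring
  simp_rw [h]
  rw [lintegral_const_mul _ (measurable_gaussianRatio _).ennreal_ofReal, ← setLIntegral_univ,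
    ← withDensity_apply _ .univ, ← stdGaussian_map_add,
    Measure.map_apply (by fun_prop) .univ]
  simp

/-- The reflection `z ↦ a - z` carries the standard Gaussian to its translate by `a`. -/
theorem lintegral_stdGaussian_reflect (a : EuclideanSpace ℝ (Fin n))
    {φ : EuclideanSpace ℝ (Fin n) → ℝ≥0∞} (hφ : Measurable φ) :
    ∫⁻ z, φ z ∂stdGaussian (EuclideanSpace ℝ (Fin n)) =
      ∫⁻ z, ENNReal.ofReal (gaussianRatio a z) * φ (a - z) ∂stdGaussian _ := by
  have hsub : Measurable fun z : EuclideanSpace ℝ (Fin n) => φ (a - z) := hφ.comp (by fun_prop)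
  have h := lintegral_withDensity_eq_lintegral_mul (stdGaussian (EuclideanSpace ℝ (Fin n)))
    (measurable_gaussianRatio a).ennreal_ofReal hsub
  rw [← stdGaussian_map_add, lintegral_map hsub (by fun_prop)] at h
  refine Eq.trans ?_ h
  conv_lhs => rw [← stdGaussian_map (LinearIsometryEquiv.neg ℝ (E := EuclideanSpace ℝ (Fin n)))]
  rw [lintegral_map hφ (by fun_prop)]
  simp

/-! ### Mixtures of two Gaussian measures -/

/-- A geometric sum over the exponents `-k, …, k`; the cofactor of `m - 1` is invariant under `m ↦
m⁻¹`. -/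
theorem pow_sub_inv_pow_eq {m : ℝ} (hm : 0 < m) (k : ℕ) :
    m ^ (k + 1) - (m ^ k)⁻¹ =
      (m - 1) * (1 + ∑ l ∈ Finset.range k, (m ^ (l + 1) + (m ^ (l + 1))⁻¹)) := by
  induction k with
  | zero => simp
  | succ k ih =>
    rw [Finset.sum_range_succ, ← add_assoc, mul_add, ← ih]
    field_simp
    ring

theorem add_inv_le_add_inv_of_one_le {x y : ℝ} (hx : 1 ≤ x) (hxy : x ≤ y) : x + x⁻¹ ≤ y + y⁻¹ := by
  have hx0 : 0 < x := by linarith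
  have hy0 : 0 < y := by linarith
  have : y + y⁻¹ - (x + x⁻¹) = (y - x) * (x * y - 1) / (x * y) := by
    field_simp
    ring
  have h : 0 ≤ (y - x) * (x * y - 1) / (x * y) :=
    div_nonneg (mul_nonneg (by linarith) (by nlinarith)) (by positivity)
  linarith

theorem sum_add_inv_le {x y : ℝ} (hy : 0 < y) (hy1 : y ≤ 1) (hxy : 1 ≤ x * y)
    (k : ℕ) : ∑ l ∈ Finset.range k, (y ^ (l + 1) + (y ^ (l + 1))⁻¹) ≤
      ∑ l ∈ Finset.range k, (x ^ (l + 1) + (x ^ (l + 1))⁻¹) := by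
  refine Finset.sum_le_sum fun l _ => ?_
  have h := add_inv_le_add_inv_of_one_le (x := (y ^ (l + 1))⁻¹) (y := x ^ (l + 1))
    (one_le_inv_iff₀.2 ⟨by positivity, pow_le_one₀ hy.le hy1⟩) ?_
  · rwa [inv_inv, add_comm] at h
  · rw [← inv_pow]
    exact pow_le_pow_left₀ (by positivity) ((inv_le_iff_one_le_mul₀ hy).2 hxy) _

/-- With `m`, `m'` the values at `r`, `r⁻¹` and `G`, `G'` their symmetric cofactors, `r (m' - 1) =
-(m - 1)`, so the difference of the two sides is `(m - 1) (G - G')`. Since `m m' ≥ 1`, both factors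
are nonnegative if `r ≥ 1` and nonpositive if `r ≤ 1`. -/
theorem inv_pow_add_le_pow_add {q r : ℝ} (hq0 : 0 < q) (hq1 : q ≤ 1) (hr : 0 < r) (k : ℕ) :
    ((1 - q + q * r) ^ k)⁻¹ + r * ((1 - q + q * r⁻¹) ^ k)⁻¹ ≤
      (1 - q + q * r) ^ (k + 1) + r * (1 - q + q * r⁻¹) ^ (k + 1) := by
  have hm : 0 < 1 - q + q * r := by nlinarith [mul_pos hq0 hr]
  have hm' : 0 < 1 - q + q * r⁻¹ := by nlinarith [mul_pos hq0 (inv_pos.2 hr)]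
  have hprod : 1 ≤ (1 - q + q * r) * (1 - q + q * r⁻¹) := by
    have : (1 - q + q * r) * (1 - q + q * r⁻¹) - 1 = q * (1 - q) * (r - 1) ^ 2 * r⁻¹ := by
      field_simp
      ring
    have : 0 ≤ q * (1 - q) * (r - 1) ^ 2 * r⁻¹ := by
      have : 0 ≤ 1 - q := by linarith
      positivity
    linarith
  have e1 : r * (1 - q + q * r⁻¹ - 1) = -(1 - q + q * r - 1) := by
    field_simp
    ring
  have h1 := pow_sub_inv_pow_eq hm k
  have h2 := pow_sub_inv_pow_eq hm' k
  set m := 1 - q + q * r with hmdef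
  set m' := 1 - q + q * r⁻¹ with hmdef'
  set G := 1 + ∑ l ∈ Finset.range k, (m ^ (l + 1) + (m ^ (l + 1))⁻¹) with hG
  set G' := 1 + ∑ l ∈ Finset.range k, (m' ^ (l + 1) + (m' ^ (l + 1))⁻¹) with hG'
  have h3 : r * (m' ^ (k + 1) - (m' ^ k)⁻¹) = -(m - 1) * G' := by
    rw [h2, ← mul_assoc, e1]
  have h4 : 0 ≤ (m - 1) * (G - G') := by
    rcases le_total 1 r with h | h
    · have hle : G' ≤ G := by
        have := inv_le_one_of_one_le₀ h
        have := sum_add_inv_le hm' (by nlinarith) hprod k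
        linarith
      exact mul_nonneg (by nlinarith) (by linarith)
    · have hle : G ≤ G' := by
        have := (one_le_inv₀ hr).2 h
        have := sum_add_inv_le hm (by nlinarith) (by rwa [mul_comm]) k
        linarith
      exact mul_nonneg_of_nonpos_of_nonpos (by nlinarith) (by linarith)
  linarith

/-- The argument of the logarithm in `rhoPoiSG`. -/
def poiSGMoment (σ : ℝ) (α : ℕ) (q : ℝ) : ℝ :=
  (1 - q) ^ (α - 1) * (α * q - q + 1) +
    ∑ l ∈ Finset.Icc 2 α,
      (α.choose l : ℝ) * (1 - q) ^ (α - l) * q ^ l * Real.exp (((l : ℝ) - 1) * rhoG σ l)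

theorem poiSGMoment_pos (σ : ℝ) {α : ℕ} (hα : 2 ≤ α) {q : ℝ} (hq : q ∈ Set.Ioc (0 : ℝ) 1) :
    0 < poiSGMoment σ α q := by
  have hq0 := hq.1
  have hq1 : 0 ≤ 1 - q := by linarith [hq.2]
  have hα' : (2 : ℝ) ≤ α := by exact_mod_cast hα
  refine add_pos_of_nonneg_of_pos (mul_nonneg (by positivity) (by nlinarith)) ?_
  refine Finset.sum_pos' (fun l _ => by positivity) ⟨α, by simp [hα], ?_⟩
  simp only [Nat.choose_self, Nat.sub_self, pow_zero]
  positivity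

theorem exp_mul_rhoPoiSG (σ : ℝ) {α : ℕ} (hα : 2 ≤ α) {q : ℝ} (hq : q ∈ Set.Ioc (0 : ℝ) 1) :
    Real.exp (((α : ℝ) - 1) * rhoPoiSG σ α q) = poiSGMoment σ α q := by
  have hα' : (2 : ℝ) ≤ α := by exact_mod_cast hα
  have : (α : ℝ) - 1 ≠ 0 := by linarith
  rw [rhoPoiSG, ← mul_assoc, mul_one_div_cancel this, one_mul]
  exact Real.exp_log (poiSGMoment_pos σ hα hq)

theorem sum_range_choose_exp (σ : ℝ) {α : ℕ} (hα : 2 ≤ α) (q : ℝ) :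
    ∑ l ∈ Finset.range (α + 1), (q ^ l * (1 - q) ^ (α - l) * α.choose l) *
      Real.exp (((l : ℝ) - 1) * rhoG σ l) = poiSGMoment σ α q := by
  obtain ⟨k, rfl⟩ := Nat.exists_eq_add_of_le' hα
  rw [poiSGMoment, ← Finset.sum_range_add_sum_Ico _ (show 2 ≤ k + 2 + 1 by omega)]
  congr 1
  -- The exponentials for `l = 0` and `l = 1` equal `1`, and these two terms merge into `(1 - q) ^
  -- (α - 1) * (α q - q + 1)`.
  · simp [Finset.sum_range_succ, rhoG]
    ring
  · refine Finset.sum_congr ?_ fun l _ => by ring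
    ext l
    simp

theorem lintegral_mixture_pow_le {σ : ℝ} (hσ : 0 < σ) {α : ℕ} (hα : 2 ≤ α) {q : ℝ}
    (hq : q ∈ Set.Ioc (0 : ℝ) 1) {a : EuclideanSpace ℝ (Fin n)} (ha : ‖a‖ ≤ σ⁻¹) :
    ∫⁻ z, ENNReal.ofReal (1 - q + q * gaussianRatio a z) ^ α ∂stdGaussian _ ≤
      ENNReal.ofReal (poiSGMoment σ α q) := by
  have hq0 := hq.1.le
  have hq1 : 0 ≤ 1 - q := by linarith [hq.2]
  have hr := (measurable_gaussianRatio a).ennreal_ofReal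
  have hexp : ∀ z, ENNReal.ofReal (1 - q + q * gaussianRatio a z) ^ α =
      ∑ l ∈ Finset.range (α + 1), ENNReal.ofReal (q ^ l * (1 - q) ^ (α - l) * α.choose l) *
        ENNReal.ofReal (gaussianRatio a z) ^ l := by
    intro z
    have hz := (gaussianRatio_pos a z).le
    rw [← ENNReal.ofReal_pow (by positivity), add_comm, add_pow,
      ENNReal.ofReal_sum_of_nonneg (fun l _ => by positivity)]
    refine Finset.sum_congr rfl fun l _ => ?_
    rw [← ENNReal.ofReal_pow hz, ← ENNReal.ofReal_mul (by positivity)]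
    ring_nf
  simp_rw [hexp]
  rw [lintegral_finsetSum _ (fun l _ => (hr.pow_const l).const_mul _),
    ← sum_range_choose_exp σ hα q, ENNReal.ofReal_sum_of_nonneg (fun l _ => by positivity)]
  refine Finset.sum_le_sum fun l _ => ?_
  rw [lintegral_const_mul _ (hr.pow_const l), lintegral_gaussianRatio_pow,
    ← ENNReal.ofReal_mul (by positivity)]
  refine ENNReal.ofReal_le_ofReal
    (mul_le_mul_of_nonneg_left (Real.exp_le_exp.2 ?_) (by positivity))
  have hsq : ‖a‖ ^ 2 ≤ (σ ^ 2)⁻¹ := by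
    rw [← inv_pow]
    gcongr
  have hl : 0 ≤ (l : ℝ) * (l - 1) / 2 := by
    rcases Nat.eq_zero_or_pos l with rfl | h
    · simp
    · have : (1 : ℝ) ≤ l := by exact_mod_cast h
      have : (0 : ℝ) ≤ (l : ℝ) - 1 := by linarith
      positivity
  calc (l : ℝ) * (l - 1) / 2 * ‖a‖ ^ 2 ≤ l * (l - 1) / 2 * (σ ^ 2)⁻¹ := by gcongr
    _ = (l - 1) * rhoG σ l := by
      rw [rhoG]
      field_simp

theorem lintegral_mixture_inv_pow_le {q : ℝ} (hq : q ∈ Set.Ioc (0 : ℝ) 1)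
    (a : EuclideanSpace ℝ (Fin n)) (k : ℕ) :
    ∫⁻ z, ENNReal.ofReal (((1 - q + q * gaussianRatio a z) ^ k)⁻¹) ∂stdGaussian _ ≤
      ∫⁻ z, ENNReal.ofReal ((1 - q + q * gaussianRatio a z) ^ (k + 1)) ∂stdGaussian _ := by
  have hr := measurable_gaussianRatio a
  have key : ∀ g : ℝ → ℝ, Measurable g → (∀ r, 0 < r → 0 ≤ g r) →
      2 * ∫⁻ z, ENNReal.ofReal (g (gaussianRatio a z)) ∂stdGaussian (EuclideanSpace ℝ (Fin n)) =
        ∫⁻ z, ENNReal.ofReal (g (gaussianRatio a z) + gaussianRatio a z *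
          g ((gaussianRatio a z)⁻¹)) ∂stdGaussian _ := by
    intro g hg hg0
    have hm : Measurable fun z => ENNReal.ofReal (g (gaussianRatio a z)) := by fun_prop
    rw [two_mul]
    -- This reflects both copies of the integral; the next line restores the first one.
    conv_lhs => rw [lintegral_stdGaussian_reflect a hm]
    conv_lhs => arg 1; rw [← lintegral_stdGaussian_reflect a hm]
    rw [← lintegral_add_left hm]
    refine lintegral_congr fun z => ?_
    have hz := gaussianRatio_pos a z
    rw [gaussianRatio_sub, ← ENNReal.ofReal_mul hz.le,
      ENNReal.ofReal_add (hg0 _ hz) (mul_nonneg hz.le (hg0 _ (inv_pos.2 hz)))]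
  have hpos : ∀ r : ℝ, 0 < r → 0 ≤ 1 - q + q * r := fun r hr => by nlinarith [hq.1, hq.2]
  have h1 := key (fun r => ((1 - q + q * r) ^ k)⁻¹) (by fun_prop)
    (fun r hr => inv_nonneg.2 (pow_nonneg (hpos r hr) _))
  have h2 := key (fun r => (1 - q + q * r) ^ (k + 1)) (by fun_prop)
    (fun r hr => pow_nonneg (hpos r hr) _)
  refine (ENNReal.mul_le_mul_iff_right two_ne_zero (by simp)).1 ?_
  rw [h1, h2]
  exact lintegral_mono fun z => ENNReal.ofReal_le_ofReal
    (inv_pow_add_le_pow_add hq.1 hq.2 (gaussianRatio_pos a z) k)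

theorem gaussian_mixture_eq_withDensity {q : ℝ} (hq : q ∈ Set.Ioc (0 : ℝ) 1)
    (a : EuclideanSpace ℝ (Fin n)) :
    ENNReal.ofReal (1 - q) • stdGaussian (EuclideanSpace ℝ (Fin n)) +
        ENNReal.ofReal q • (stdGaussian _).map (fun z => z + a) =
      (stdGaussian _).withDensity fun z => ENNReal.ofReal (1 - q + q * gaussianRatio a z) := by
  have hr := (measurable_gaussianRatio a).ennreal_ofReal
  have : (fun z => ENNReal.ofReal (1 - q + q * gaussianRatio a z)) =
      (fun _ => ENNReal.ofReal (1 - q)) +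
        ENNReal.ofReal q • fun z => ENNReal.ofReal (gaussianRatio a z) := by
    funext z
    have hz := (gaussianRatio_pos a z).le
    simp only [Pi.add_apply, Pi.smul_apply, smul_eq_mul]
    rw [← ENNReal.ofReal_mul hq.1.le, ← ENNReal.ofReal_add (by linarith [hq.2])
      (mul_nonneg hq.1.le hz)]
  rw [this, withDensity_add_left measurable_const, withDensity_const,
    withDensity_smul _ hr, stdGaussian_map_add]

theorem momentBound_mixture {σ : ℝ} (hσ : 0 < σ) {α : ℕ} (hα : 2 ≤ α) {q : ℝ}
    (hq : q ∈ Set.Ioc (0 : ℝ) 1) {a : EuclideanSpace ℝ (Fin n)} (ha : ‖a‖ ≤ σ⁻¹) :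
    MomentBound α (ENNReal.ofReal (poiSGMoment σ α q))
      (ENNReal.ofReal (1 - q) • stdGaussian (EuclideanSpace ℝ (Fin n)) +
        ENNReal.ofReal q • (stdGaussian _).map (fun z => z + a)) (stdGaussian _) := by
  have hr := measurable_gaussianRatio a
  rw [gaussian_mixture_eq_withDensity hq]
  refine .of_withDensity (by exact_mod_cast hα) (by fun_prop) ?_
  simp only [ENNReal.rpow_natCast]
  exact lintegral_mixture_pow_le hσ hα hq ha

/-- The density is now `m⁻¹`, and its moment of order `α` under the mixture is `∫ m ^ (1 - α)` under
the standard Gaussian. -/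
theorem momentBound_mixture_symm {σ : ℝ} (hσ : 0 < σ) {α : ℕ} (hα : 2 ≤ α) {q : ℝ}
    (hq : q ∈ Set.Ioc (0 : ℝ) 1) {a : EuclideanSpace ℝ (Fin n)} (ha : ‖a‖ ≤ σ⁻¹) :
    MomentBound α (ENNReal.ofReal (poiSGMoment σ α q)) (stdGaussian _)
      (ENNReal.ofReal (1 - q) • stdGaussian (EuclideanSpace ℝ (Fin n)) +
        ENNReal.ofReal q • (stdGaussian _).map (fun z => z + a)) := by
  have hr := measurable_gaussianRatio a
  have hpos : ∀ z, 0 < 1 - q + q * gaussianRatio a z := fun z => by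
    nlinarith [mul_pos hq.1 (gaussianRatio_pos a z), hq.2]
  rw [gaussian_mixture_eq_withDensity hq]
  set m := fun z => ENNReal.ofReal (1 - q + q * gaussianRatio a z) with hmdef
  have hm : Measurable m := by fun_prop
  have hm0 : ∀ z, m z ≠ 0 := fun z => by simpa [m] using hpos z
  have hinv := withDensity_inv_same (μ := stdGaussian (EuclideanSpace ℝ (Fin n))) hm
    (.of_forall hm0) (.of_forall fun z => ENNReal.ofReal_ne_top)
  have h := MomentBound.of_withDensity (α := α) (Q := (stdGaussian _).withDensity m)
    (C := ENNReal.ofReal (poiSGMoment σ α q)) (by exact_mod_cast hα) hm.inv ?_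
  · rwa [show m⁻¹ = fun z => (m z)⁻¹ from rfl, hinv] at h
  simp only [ENNReal.rpow_natCast]
  rw [lintegral_withDensity_eq_lintegral_mul _ hm (hm.inv.pow_const _)]
  obtain ⟨k, rfl⟩ := Nat.exists_eq_add_of_le' (show 1 ≤ α by omega)
  have e : ∀ z, (m * fun z => m⁻¹ z ^ (k + 1)) z =
      ENNReal.ofReal (((1 - q + q * gaussianRatio a z) ^ k)⁻¹) := by
    intro z
    rw [Pi.mul_apply, Pi.inv_apply, pow_succ', ← mul_assoc,
      ENNReal.mul_inv_cancel (hm0 z) ENNReal.ofReal_ne_top, one_mul, hmdef,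
      ← ENNReal.ofReal_inv_of_pos (hpos z), ← ENNReal.ofReal_pow (inv_nonneg.2 (hpos z).le),
      inv_pow]
  simp_rw [e]
  refine (lintegral_mixture_inv_pow_le hq a k).trans ?_
  simp_rw [fun z => ENNReal.ofReal_pow (hpos z).le (k + 1)]
  exact lintegral_mixture_pow_le hσ hα hq ha

/-! ### Poisson sampling -/

theorem poissonWeight_nonneg {X : Type*} [DecidableEq X] {q : X → ℝ}
    (hq : ∀ x, q x ∈ Set.Ioc (0 : ℝ) 1) (D S : Finset X) : 0 ≤ poissonWeight q D S :=
  Finset.prod_nonneg fun x _ => by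
    split_ifs
    · exact (hq x).1.le
    · linarith [(hq x).2]

/-- Conditioning on whether `d` is drawn. Values in a module let the same identity serve for weights
and for measures, and for records and for clients. -/
theorem sum_poissonWeight_insert {X M : Type*} [DecidableEq X] [AddCommMonoid M] [Module ℝ≥0∞ M]
    {q : X → ℝ} (hq : ∀ x, q x ∈ Set.Ioc (0 : ℝ) 1) {d : X} {D : Finset X} (hd : d ∉ D)
    (F : Finset X → M) :
    ∑ S ∈ (insert d D).powerset, ENNReal.ofReal (poissonWeight q (insert d D) S) • F S =
      ∑ S ∈ D.powerset, ENNReal.ofReal (poissonWeight q D S) •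
        (ENNReal.ofReal (1 - q d) • F S + ENNReal.ofReal (q d) • F (insert d S)) := by
  rw [Finset.sum_powerset_insert hd, ← Finset.sum_add_distrib]
  refine Finset.sum_congr rfl fun S hS => ?_
  have hdS : d ∉ S := fun h => hd (Finset.mem_powerset.1 hS h)
  have h1 : poissonWeight q (insert d D) S = poissonWeight q D S * (1 - q d) := by
    rw [poissonWeight, Finset.prod_insert hd, if_neg hdS, mul_comm, poissonWeight]
  have h2 : poissonWeight q (insert d D) (insert d S) = poissonWeight q D S * q d := by
    rw [poissonWeight, Finset.prod_insert hd, if_pos (Finset.mem_insert_self _ _), mul_comm,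
      poissonWeight]
    congr 1
    refine Finset.prod_congr rfl fun x hx => ?_
    have : x ≠ d := fun h => hd (h ▸ hx)
    simp [this]
  rw [h1, h2, ENNReal.ofReal_mul (poissonWeight_nonneg hq D S),
    ENNReal.ofReal_mul (poissonWeight_nonneg hq D S), mul_smul, mul_smul, smul_add]

theorem sum_ofReal_poissonWeight {X : Type*} [DecidableEq X] {q : X → ℝ}
    (hq : ∀ x, q x ∈ Set.Ioc (0 : ℝ) 1) (D : Finset X) :
    ∑ S ∈ D.powerset, ENNReal.ofReal (poissonWeight q D S) = 1 := by
  induction D using Finset.induction_on with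
  | empty => simp [poissonWeight]
  | insert d D hd ih =>
    have h := sum_poissonWeight_insert hq hd (fun _ => (1 : ℝ≥0∞))
    simp only [smul_eq_mul, mul_one] at h
    rw [h, ← ENNReal.ofReal_add (by linarith [(hq d).2]) (hq d).1.le]
    simpa using ih

theorem isProbabilityMeasure_poissonMixture {X Ω : Type*} [DecidableEq X] [MeasurableSpace Ω]
    {q : X → ℝ} (hq : ∀ x, q x ∈ Set.Ioc (0 : ℝ) 1) (D : Finset X) (P : Finset X → Measure Ω)
    (hP : ∀ S, IsProbabilityMeasure (P S)) :
    IsProbabilityMeasure (∑ S ∈ D.powerset, ENNReal.ofReal (poissonWeight q D S) • P S) := by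
  constructor
  simp only [Measure.finsetSum_apply, Measure.smul_apply, measure_univ, smul_eq_mul, mul_one]
  exact sum_ofReal_poissonWeight hq D

namespace MomentBound

variable {Ω : Type*} [MeasurableSpace Ω] {α : ℝ} {C : ℝ≥0∞}

theorem poissonMixture (hα : 1 < α) {X : Type*} [DecidableEq X] {q : X → ℝ}
    (hq : ∀ x, q x ∈ Set.Ioc (0 : ℝ) 1) (D : Finset X) {P Q : Finset X → Measure Ω}
    (h : ∀ S ∈ D.powerset, MomentBound α C (P S) (Q S)) :
    MomentBound α C (∑ S ∈ D.powerset, ENNReal.ofReal (poissonWeight q D S) • P S)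
      (∑ S ∈ D.powerset, ENNReal.ofReal (poissonWeight q D S) • Q S) := by
  have := MomentBound.sum hα D.powerset (fun S => ENNReal.ofReal (poissonWeight q D S))
    (fun _ => C) h
  rwa [← Finset.sum_mul, sum_ofReal_poissonWeight hq, one_mul] at this

theorem add_smul (hα : 1 < α) {C₁ C₂ : ℝ≥0∞} {P₁ P₂ Q₁ Q₂ : Measure Ω} (w₁ w₂ : ℝ≥0∞)
    (h₁ : MomentBound α C₁ P₁ Q₁) (h₂ : MomentBound α C₂ P₂ Q₂) :
    MomentBound α (w₁ * C₁ + w₂ * C₂) (w₁ • P₁ + w₂ • P₂) (w₁ • Q₁ + w₂ • Q₂) := by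
  simpa using MomentBound.sum hα (Finset.univ : Finset Bool) (fun b => cond b w₁ w₂)
    (fun b => cond b C₁ C₂) (P := fun b => cond b P₁ P₂) (Q := fun b => cond b Q₁ Q₂)
    (by rintro (_ | _) _ <;> assumption)

end MomentBound

/-! ### The Poisson-sampled Gaussian mechanism -/

theorem measurable_const_add_smul (σ : ℝ) (v : EuclideanSpace ℝ (Fin n)) :
    Measurable fun z : EuclideanSpace ℝ (Fin n) => v + σ • z := by
  fun_prop

instance isProbabilityMeasure_gaussianMech (σ : ℝ) (v : EuclideanSpace ℝ (Fin n)) :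
    IsProbabilityMeasure (gaussianMech σ v) :=
  Measure.isProbabilityMeasure_map (measurable_const_add_smul σ v).aemeasurable

theorem isProbabilityMeasure_poiSG {X : Type*} [DecidableEq X] (σ : ℝ) {q : X → ℝ}
    (hq : ∀ x, q x ∈ Set.Ioc (0 : ℝ) 1) (f : Finset X → EuclideanSpace ℝ (Fin n)) (D : Finset X) :
    IsProbabilityMeasure (poiSG σ q f D) :=
  isProbabilityMeasure_poissonMixture hq D _ fun _ => inferInstance

theorem gaussianMech_mixture_eq_map {σ : ℝ} (hσ : σ ≠ 0) (w₁ w₂ : ℝ≥0∞)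
    (u v : EuclideanSpace ℝ (Fin n)) :
    w₁ • gaussianMech σ u + w₂ • gaussianMech σ v =
      (w₁ • stdGaussian (EuclideanSpace ℝ (Fin n)) +
        w₂ • (stdGaussian _).map (fun z => z + σ⁻¹ • (v - u))).map (fun z => u + σ • z) := by
  have hm := measurable_const_add_smul σ u
  rw [Measure.map_add _ _ hm, Measure.map_smul, Measure.map_smul,
    Measure.map_map hm (by fun_prop), gaussianMech, gaussianMech]
  congr 3
  funext z
  simp only [Function.comp_apply, smul_add, smul_inv_smul₀ hσ]
  abel

section

variable {X : Type*} [DecidableEq X] {σ : ℝ} {q : X → ℝ}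
  {α : ℕ} {d : X} {D : Finset X}

theorem norm_inv_smul_le (hσ : 0 < σ) {v : EuclideanSpace ℝ (Fin n)} (hv : ‖v‖ ≤ 1) :
    ‖σ⁻¹ • v‖ ≤ σ⁻¹ := by
  rw [norm_smul, Real.norm_of_nonneg (inv_nonneg.2 hσ.le)]
  exact mul_le_of_le_one_right (inv_nonneg.2 hσ.le) hv

/-- Given the sample `S` of the other records, the query changes by at most `1`; rescaling by `σ⁻¹`
leaves a standard Gaussian pair. The constant does not depend on `S`, so mixing preserves it. -/
theorem momentBound_poiSG (hσ : 0 < σ) (hq : ∀ x, q x ∈ Set.Ioc (0 : ℝ) 1) (hα : 2 ≤ α)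
    {f : Finset X → EuclideanSpace ℝ (Fin n)} (hf : ∀ S c, ‖f (insert c S) - f S‖ ≤ 1)
    (hd : d ∉ D) :
    MomentBound α (ENNReal.ofReal (poiSGMoment σ α (q d))) (poiSG σ q f (insert d D))
      (poiSG σ q f D) := by
  rw [poiSG, poiSG, sum_poissonWeight_insert hq hd]
  refine .poissonMixture (by exact_mod_cast hα) hq D fun S _ => ?_
  rw [gaussianMech_mixture_eq_map hσ.ne']
  exact (momentBound_mixture hσ hα (hq d) (norm_inv_smul_le hσ (hf S d))).map
    (measurable_const_add_smul σ _)

theorem momentBound_poiSG_symm (hσ : 0 < σ) (hq : ∀ x, q x ∈ Set.Ioc (0 : ℝ) 1) (hα : 2 ≤ α)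
    {f : Finset X → EuclideanSpace ℝ (Fin n)} (hf : ∀ S c, ‖f (insert c S) - f S‖ ≤ 1)
    (hd : d ∉ D) :
    MomentBound α (ENNReal.ofReal (poiSGMoment σ α (q d))) (poiSG σ q f D)
      (poiSG σ q f (insert d D)) := by
  rw [poiSG, poiSG, sum_poissonWeight_insert hq hd]
  refine .poissonMixture (by exact_mod_cast hα) hq D fun S _ => ?_
  rw [gaussianMech_mixture_eq_map hσ.ne']
  exact (momentBound_mixture_symm hσ hα (hq d) (norm_inv_smul_le hσ (hf S d))).map
    (measurable_const_add_smul σ _)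

/-! ### Adaptive composition -/

theorem measurable_snoc {E : Type*} [MeasurableSpace E] (r : ℕ) :
    Measurable fun p : (Fin r → E) × E => (Fin.snoc p.1 p.2 : Fin (r + 1) → E) := by
  refine measurable_pi_iff.2 fun j => ?_
  induction j using Fin.lastCases with
  | last => simpa using measurable_snd
  | cast j =>
    simp only [Fin.snoc_castSucc]
    exact (measurable_pi_apply j).comp measurable_fst

theorem measurable_snoc_right {E : Type*} [MeasurableSpace E] {r : ℕ} (h : Fin r → E) :
    Measurable fun y : E => (Fin.snoc h y : Fin (r + 1) → E) :=
  (measurable_snoc r).comp measurable_prodMk_left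

/-- Composition needs a measurable kernel: the mass of a set is a finite sum of Gaussian measures of
sections of measurable sets. -/
theorem measurable_poiSG_map_snoc (σ : ℝ) (q : X → ℝ) {r : ℕ}
    {f : (Fin r → EuclideanSpace ℝ (Fin n)) → Finset X → EuclideanSpace ℝ (Fin n)}
    (hf : ∀ S, Measurable fun h => f h S) (D : Finset X) :
    Measurable fun h => (poiSG σ q (f h) D).map fun y =>
      (Fin.snoc h y : Fin (r + 1) → EuclideanSpace ℝ (Fin n)) := by
  refine Measure.measurable_of_measurable_coe _ fun s hs => ?_
  have e : ∀ h, (poiSG σ q (f h) D).map (fun y =>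
      (Fin.snoc h y : Fin (r + 1) → EuclideanSpace ℝ (Fin n))) s =
      ∑ S ∈ D.powerset, ENNReal.ofReal (poissonWeight q D S) *
        stdGaussian _ (Prod.mk h ⁻¹' ((fun p : (Fin r → EuclideanSpace ℝ (Fin n)) ×
          EuclideanSpace ℝ (Fin n) => (Fin.snoc p.1 (f p.1 S + σ • p.2) :
            Fin (r + 1) → EuclideanSpace ℝ (Fin n))) ⁻¹' s)) := by
    intro h
    have hm := measurable_snoc_right (E := EuclideanSpace ℝ (Fin n)) h
    rw [Measure.map_apply hm hs, poiSG, Measure.finsetSum_apply]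
    refine Finset.sum_congr rfl fun S _ => ?_
    rw [Measure.smul_apply, smul_eq_mul, gaussianMech,
      Measure.map_apply (measurable_const_add_smul σ _) (hm hs)]
    rfl
  simp_rw [e]
  refine Finset.measurable_sum _ fun S _ => Measurable.const_mul ?_ _
  refine measurable_measure_prodMk_left ?_
  refine ((measurable_snoc r).comp (measurable_fst.prodMk ?_)) hs
  exact ((hf S).comp measurable_fst).add (measurable_snd.const_smul σ)

variable {f : (r : ℕ) → (Fin r → EuclideanSpace ℝ (Fin n)) → Finset X → EuclideanSpace ℝ (Fin n)}

theorem isProbabilityMeasure_poiSGComp (σ : ℝ) (hq : ∀ x, q x ∈ Set.Ioc (0 : ℝ) 1)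
    (hf : ∀ r S, Measurable fun h => f r h S) (D : Finset X) (τ : ℕ) :
    IsProbabilityMeasure (poiSGComp σ q f D τ) := by
  induction τ with
  | zero => exact Measure.dirac.isProbabilityMeasure
  | succ r ih =>
    refine isProbabilityMeasure_bind (measurable_poiSG_map_snoc σ q (hf r) D).aemeasurable
      (.of_forall fun h => ?_)
    have := isProbabilityMeasure_poiSG σ hq (f r h) D
    exact Measure.isProbabilityMeasure_map (measurable_snoc_right h).aemeasurable

/-- The one-step bound is uniform in the history, so each step contributes one factor `C`. -/
theorem momentBound_poiSGComp {α : ℝ} (hα : 1 < α) {C : ℝ≥0∞} {D D' : Finset X}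
    (hf : ∀ r S, Measurable fun h => f r h S)
    (h : ∀ r h, MomentBound α C (poiSG σ q (f r h) D) (poiSG σ q (f r h) D')) (τ : ℕ) :
    MomentBound α (C ^ τ) (poiSGComp σ q f D τ) (poiSGComp σ q f D' τ) := by
  induction τ with
  | zero => simpa [poiSGComp] using MomentBound.refl hα _
  | succ r ih =>
    rw [pow_succ]
    exact ih.bind hα (measurable_poiSG_map_snoc σ q (hf r) D)
      (measurable_poiSG_map_snoc σ q (hf r) D') fun y => (h r y).map (measurable_snoc_right y)

theorem isRDP_poiSGComp (hσ : 0 < σ) (hq : ∀ x, q x ∈ Set.Ioc (0 : ℝ) 1) (hα : 2 ≤ α)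
    (hf : ∀ r S, Measurable fun h => f r h S)
    (hs : ∀ r h S c, ‖f r h (insert c S) - f r h S‖ ≤ 1) (d : X) (τ : ℕ) :
    IsRDP (LocalAdj d) α (τ * rhoPoiSG σ α (q d)) fun D => poiSGComp σ q f D τ := by
  rintro D D' ⟨hd, rfl⟩
  have hα' : (1 : ℝ) < α := by exact_mod_cast hα
  have hprob := isProbabilityMeasure_poiSGComp σ hq hf
  have hd' : d ∉ D.erase d := Finset.notMem_erase d D
  have hC : ENNReal.ofReal (Real.exp (((α : ℝ) - 1) * (τ * rhoPoiSG σ α (q d)))) =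
      ENNReal.ofReal (poiSGMoment σ α (q d)) ^ τ := by
    rw [← exp_mul_rhoPoiSG σ hα (hq d), ← ENNReal.ofReal_pow (Real.exp_pos _).le,
      ← Real.exp_nat_mul]
    ring_nf
  have := hprob D τ
  have := hprob (D.erase d) τ
  refine max_le ((renyiDiv_le_iff hα' _ _).2 ?_) ((renyiDiv_le_iff hα' _ _).2 ?_) <;> rw [hC]
  · refine momentBound_poiSGComp hα' hf (fun r h => ?_) τ
    have := momentBound_poiSG hσ hq hα (hs r h) hd'
    rwa [Finset.insert_erase hd] at this
  · refine momentBound_poiSGComp hα' hf (fun r h => ?_) τ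
    have := momentBound_poiSG_symm hσ hq hα (hs r h) hd'
    rwa [Finset.insert_erase hd] at this

end

theorem IsRDP.map {𝔻 Ω Ω' : Type*} [MeasurableSpace Ω] [MeasurableSpace Ω']
    {adj : 𝔻 → 𝔻 → Prop} {α ρ : ℝ} (hα : 1 < α) {A : 𝔻 → Measure Ω}
    (hA : ∀ D, IsProbabilityMeasure (A D)) (h : IsRDP adj α ρ A) {g : Ω → Ω'}
    (hg : Measurable g) : IsRDP adj α ρ fun D => (A D).map g := by
  intro D D' hD
  have hmap : ∀ D, IsProbabilityMeasure ((A D).map g) := fun D =>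
    Measure.isProbabilityMeasure_map hg.aemeasurable
  have h' := max_le_iff.1 (h D D' hD)
  exact max_le
    ((renyiDiv_le_iff hα _ _).2 (((renyiDiv_le_iff hα _ _).1 h'.1).map hg))
    ((renyiDiv_le_iff hα _ _).2 (((renyiDiv_le_iff hα _ _).1 h'.2).map hg))

/-! ### Client sampling -/

theorem ofReal_exp_mul_rhoAmp {lam : ℝ} (hlam : lam ∈ Set.Ioc (0 : ℝ) 1) {α : ℝ} (hα : 1 < α) (ρ : ℝ) :
    ENNReal.ofReal (Real.exp ((α - 1) * rhoAmp lam α ρ)) =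
      ENNReal.ofReal (1 - lam) * 1 +
        ENNReal.ofReal lam * ENNReal.ofReal (Real.exp ((α - 1) * ρ)) := by
  have h1 : α - 1 ≠ 0 := by linarith
  have h2 : 0 ≤ 1 - lam := by linarith [hlam.2]
  have h3 := hlam.1
  rw [rhoAmp, ← mul_assoc, mul_one_div_cancel h1, one_mul, Real.exp_log (by positivity), mul_one,
    ← ENNReal.ofReal_mul h3.le, ← ENNReal.ofReal_add h2 (by positivity)]

section

variable {ι X V : Type*} [NormedAddCommGroup V] [NormedSpace ℝ V] [MeasurableSpace V] {lam : ℝ}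

theorem measurable_clientAvg [BorelSpace V] [SecondCountableTopology V] (x : V) (ω : Finset ι) : Measurable (clientAvg x ω) := by
  unfold clientAvg
  split_ifs
  · exact (Finset.measurable_sum _ fun i _ => measurable_pi_apply i).const_smul _
  · exact measurable_const

variable [Fintype ι] [DecidableEq ι]

theorem globalRound_eq (hlam : lam ∈ Set.Ioc (0 : ℝ) 1) (A : ι → Finset X → V → Measure V) (x : V)
    (𝒟 : ι → Finset X) (i : ι) :
    globalRound lam A x 𝒟 =
      ∑ ω ∈ (Finset.univ.erase i).powerset,
        ENNReal.ofReal (poissonWeight (fun _ => lam) (Finset.univ.erase i) ω) •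
        (ENNReal.ofReal (1 - lam) •
            (Measure.pi fun k : ω => A k (𝒟 k) x).map (clientAvg x ω) +
          ENNReal.ofReal lam •
            (Measure.pi fun k : (insert i ω : Finset ι) => A k (𝒟 k) x).map
              (clientAvg x (insert i ω))) := by
  have h := sum_poissonWeight_insert (q := fun _ : ι => lam) (fun _ => hlam)
    (Finset.notMem_erase i Finset.univ)
    (fun ω => (Measure.pi fun k : ω => A k (𝒟 k) x).map (clientAvg x ω))
  rw [Finset.insert_erase (Finset.mem_univ i), Finset.powerset_univ] at h
  exact h

variable [BorelSpace V] [SecondCountableTopology V]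

theorem isProbabilityMeasure_globalRound (hlam : lam ∈ Set.Ioc (0 : ℝ) 1)
    {A : ι → Finset X → V → Measure V} (hA : ∀ k D y, IsProbabilityMeasure (A k D y)) (x : V)
    (𝒟 : ι → Finset X) : IsProbabilityMeasure (globalRound lam A x 𝒟) := by
  have h := isProbabilityMeasure_poissonMixture (q := fun _ : ι => lam) (fun _ => hlam)
    Finset.univ (fun ω => (Measure.pi fun k : ω => A k (𝒟 k) x).map (clientAvg x ω))
    fun ω => Measure.isProbabilityMeasure_map (measurable_clientAvg x ω).aemeasurable
  rwa [Finset.powerset_univ] at h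

/-- If client `i` is not drawn, the two laws coincide; if it is drawn, the product laws differ in
one factor, and averaging is post-processing. -/
theorem momentBound_globalRound (hlam : lam ∈ Set.Ioc (0 : ℝ) 1)
    {A : ι → Finset X → V → Measure V} (hA : ∀ k D y, IsProbabilityMeasure (A k D y)) {α : ℝ}
    (hα : 1 < α) {C : ℝ≥0∞} {x : V} {𝒟 𝒟' : ι → Finset X} {i : ι}
    (hne : ∀ k, k ≠ i → 𝒟 k = 𝒟' k) (h : MomentBound α C (A i (𝒟 i) x) (A i (𝒟' i) x)) :
    MomentBound α (ENNReal.ofReal (1 - lam) * 1 + ENNReal.ofReal lam * C)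
      (globalRound lam A x 𝒟) (globalRound lam A x 𝒟') := by
  rw [globalRound_eq hlam A x 𝒟 i, globalRound_eq hlam A x 𝒟' i]
  refine .poissonMixture hα (fun _ => hlam) _ fun ω hω => .add_smul hα _ _ ?_ ?_
  · have hpi : (fun k : ω => A k (𝒟 k) x) = fun k : ω => A k (𝒟' k) x :=
      funext fun k => by
        rw [hne k (Finset.ne_of_mem_erase (Finset.mem_powerset.1 hω k.2))]
    rw [hpi]
    exact (MomentBound.refl hα _).map (measurable_clientAvg x ω)
  · refine (MomentBound.pi hα ⟨i, Finset.mem_insert_self i ω⟩ h fun k hk => ?_).map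
      (measurable_clientAvg x _)
    rw [hne k fun hki => hk (Subtype.ext hki)]

theorem IsRDP.globalRound [DecidableEq X] (hlam : lam ∈ Set.Ioc (0 : ℝ) 1)
    {A : ι → Finset X → V → Measure V} (hA : ∀ k D y, IsProbabilityMeasure (A k D y)) {α : ℝ}
    (hα : 1 < α) {ρ : ℝ} {i : ι} {d : X} {x : V}
    (h : IsRDP (LocalAdj d) α ρ fun D => A i D x) :
    IsRDP (FedAdj i d) α (rhoAmp lam α ρ) (globalRound lam A x) := by
  rintro 𝒟 𝒟' ⟨hd, rfl⟩
  have hP := isProbabilityMeasure_globalRound hlam hA x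
  have h' := max_le_iff.1 (h (𝒟 i) ((𝒟 i).erase d) ⟨hd, rfl⟩)
  rw [renyiDiv_le_iff hα, renyiDiv_le_iff hα] at h'
  refine max_le ((renyiDiv_le_iff hα _ _).2 ?_) ((renyiDiv_le_iff hα _ _).2 ?_) <;>
    rw [ofReal_exp_mul_rhoAmp hlam hα]
  · exact momentBound_globalRound hlam hA hα (i := i) (fun k hk => by simp [hk])
      (by simpa using h'.1)
  · exact momentBound_globalRound hlam hA hα (i := i) (fun k hk => by simp [hk])
      (by simpa using h'.2)

end

end

/-! ### Assembly: local composition, post-processing, client amplification. -/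

theorem mainTheorem2
    -- clients, records, dimension of one step, space of model parameters
    {ι : Type*} [Fintype ι] [DecidableEq ι] {X : Type*} [DecidableEq X] {n : ℕ}
    {V : Type*} [NormedAddCommGroup V] [NormedSpace ℝ V] [MeasurableSpace V] [BorelSpace V]
    [SecondCountableTopology V]
    -- client sampling probability, record sampling probabilities
    (lam : ℝ) (hlam : lam ∈ Set.Ioc (0 : ℝ) 1)
    (q : ι → X → ℝ) (hq : ∀ i x, q i x ∈ Set.Ioc (0 : ℝ) 1)
    -- the target record `d` of client `i` and the current global model `x`
    (i : ι) (d : X) (x : V) :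
    -- amplification by client sampling, for arbitrary local algorithms
    (∀ A : ι → Finset X → V → Measure V, (∀ k D y, IsProbabilityMeasure (A k D y)) →
      ∀ α : ℝ, 1 < α → ∀ ρ : ℝ,
        IsRDP (LocalAdj d) α ρ (fun D => A i D x) →
        IsRDP (FedAdj i d) α (rhoAmp lam α ρ) (globalRound lam A x)) ∧
    -- the local multi-step update with noise level `σ` and `τ` steps, and the resulting bound on
    -- the whole round when client `k` uploads a data-independent function of its `τ` outputs
    (∀ σ : ℝ, 0 < σ → ∀ τ : ℕ,
      ∀ f : ι → V → (r : ℕ) → (Fin r → EuclideanSpace ℝ (Fin n)) → Finset X →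
          EuclideanSpace ℝ (Fin n),
        (∀ k y r S, Measurable fun h => f k y r h S) →
        (∀ k y r h S c, ‖f k y r h (insert c S) - f k y r h S‖ ≤ 1) →
        ∀ α : ℕ, 2 ≤ α →
          IsRDP (LocalAdj d) α (τ * rhoPoiSG σ α (q i d))
            (fun D => poiSGComp σ (q i) (f i x) D τ) ∧
          ∀ g : ι → V → (Fin τ → EuclideanSpace ℝ (Fin n)) → V,
            (∀ k y, Measurable (g k y)) →
            IsRDP (FedAdj i d) α (rhoAmp lam α (τ * rhoPoiSG σ α (q i d)))
              (globalRound lam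
                (fun k D y => (poiSGComp σ (q k) (f k y) D τ).map (g k y)) x)) := by
  refine ⟨fun A hA α hα ρ h => h.globalRound hlam hA hα, fun σ hσ τ f hf hs α hα => ?_⟩
  have hα' : (1 : ℝ) < α := by exact_mod_cast hα
  have hprob : ∀ k y D, IsProbabilityMeasure (poiSGComp σ (q k) (f k y) D τ) := fun k y D =>
    isProbabilityMeasure_poiSGComp σ (hq k) (hf k y) D τ
  have hloc := isRDP_poiSGComp hσ (hq i) hα (hf i x) (hs i x) d τ
  refine ⟨hloc, fun g hg => ?_⟩
  refine IsRDP.globalRound hlam (fun k D y => ?_) hα' (hloc.map hα' (hprob i x) (hg i x))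
  have := hprob k y D
  exact Measure.isProbabilityMeasure_map (hg k y).aemeasurable
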